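/- For $x\in\mathbb R^3$ let $x_\times$ be the $3\times3$ skew-symmetric matrix with $x_\times y=x\times y$ for all $y$ (also written $[x]_\times$), let $\|\cdot\|$ be the Euclidean norm, and let $$J_L(x)=\sum_{n\ge 0}\frac{x_\times^n}{(n+1)!},\qquad H_L(x)=\sum_{n\ge 0}\frac{x_\times^n}{(n+2)!}.$$ Let $\omega_k,a_k\in\mathbb R^3$ be the IMU angular-velocity and acceleration measurements, constant on $[0,\tau]$ with $\tau>0$, let $\hat b_g,\hat b_a\in\mathbb R^3$ be the gyroscope and accelerometer bias estimates, and let $\hat R_k\in SO(3)$. Put $\omega=\omega_k-\hat b_g$, $a=a_k-\hat b_a$, assume $\omega\neq 0$, and let $\hat R(t)=\hat R_k\exp(t\omega_\times)$. The error state (orientation, velocity, position, gyroscope bias, accelerometer bias) in $\mathbb R^{15}$ satisfies a linear time-varying stochastic differential equation $\dot{\tilde x}=F(t)\tilde x+n$ with additive white noise $n$ and $$F(t)=\begin{bmatrix}-\omega_\times&0&0&-I_3&0\\-\hat R(t)a_\times&0&0&0&-\hat R(t)\\0&I_3&0&0&0\\0&0&0&0&0\\0&0&0&0&0\end{bmatrix}.$$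 Its state transition matrix $\Phi(t,s)$ on $[0,\tau]$, defined by $\partial_t\Phi(t,s)=F(t)\Phi(t,s)$ and $\Phi(s,s)=I_{15}$, exists, and for every $t\in[0,\tau]$ $$\Phi(t,0)=\begin{bmatrix}\exp(-t\omega_\times)&0&0&-tJ_L(-t\omega)&0\\\Phi_{v\theta}(t)&I_3&0&\Phi_{v\omega}(t)&\Phi_{va}(t)\\\Phi_{p\theta}(t)&tI_3&I_3&\Phi_{p\omega}(t)&\Phi_{pa}(t)\\0&0&0&I_3&0\\0&0&0&0&I_3\end{bmatrix},$$ where, with $\Delta(t)=\exp(t\omega_\times)(I_3-t\omega_\times)-I_3$, $$\Phi_{v\theta}(t)=-t\hat R_k[J_L(t\omega)a]_\times,\qquad \Phi_{va}(t)=-t\hat R_kJ_L(t\omega),$$ $$\Phi_{p\theta}(t)=-t^2\hat R_k[H_L(t\omega)a]_\times,\qquad \Phi_{pa}(t)=-t^2\hat R_kH_L(t\omega),$$ $$\Phi_{v\omega}(t)=\hat R_k\Delta(t)\frac{a_\times}{\|\omega\|^2}\Bigl(I_3+\frac{\omega_\times^2}{\|\omega\|^2}\Bigr)+t\hat R_k\Bigl(\frac{\omega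 a^\top}{\|\omega\|^2}\bigl(J_L(-t\omega)-I_3\bigr)+\frac{a^\top\omega}{\|\omega\|^2}\bigl(J_L(t\omega)-I_3\bigr)\Bigr),$$ $$\Phi_{p\omega}(t)=\hat R_k\Bigl(tJ_L(t\omega)-\frac{\omega_\times}{\|\omega\|^2}\Delta(t)-tI_3\Bigr)\frac{a_\times}{\|\omega\|^2}\Bigl(I_3+\frac{\omega_\times^2}{\|\omega\|^2}\Bigr)+\frac{t^2}{2}\hat R_k\Bigl(\frac{\omega a^\top}{\|\omega\|^2}\bigl(2H_L(-t\omega)-I_3\bigr)+\frac{a^\top\omega}{\|\omega\|^2}\bigl(2H_L(t\omega)-I_3\bigr)\Bigr).$$ In particular every solution of the homogeneous system $\dot x=F(t)x$ on $[0,\tau]$ satisfies $x(t)=\Phi(t,0)x(0)$. -/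

import Mathlib

noncomputable section

namespace IMU

open Matrix

/-- Vectors of `ℝ³` with the Euclidean norm. -/
abbrev Vec3 := EuclideanSpace ℝ (Fin 3)

/-- Real `3 × 3` matrices. -/
abbrev Mat3 := Matrix (Fin 3) (Fin 3) ℝ

/-- Real `15 × 15` matrices, with rows and columns indexed by (block, coordinate in the block).
The five blocks `0, 1, 2, 3, 4` are the errors of orientation, velocity, position, gyroscope bias
and accelerometer bias. -/
abbrev Mat15 := Matrix (Fin 5 × Fin 3) (Fin 5 × Fin 3) ℝ

/-- The `15 × 15` matrix with the given `3 × 3` blocks. -/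
def ofBlocks (B : Matrix (Fin 5) (Fin 5) Mat3) : Mat15 :=
  Matrix.of fun p q => B p.1 q.1 p.2 q.2

/-- The skew-symmetric matrix `x_×`, so that `x_× y` is the cross product of `x` and `y`. -/
def skew (x : Vec3) : Mat3 :=
  !![0, -x 2, x 1;
     x 2, 0, -x 0;
     -x 1, x 0, 0]

/-- The product of a matrix and a vector, as a Euclidean vector. -/
def act (M : Mat3) (x : Vec3) : Vec3 := WithLp.toLp 2 (M *ᵥ x.ofLp)

/-- The left Jacobian of `SO(3)`: `J_L(x) = ∑ x_×ⁿ / (n+1)!`. -/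
def JL (x : Vec3) : Mat3 := ∑' n : ℕ, (1 / (Nat.factorial (n + 1) : ℝ)) • skew x ^ n

/-- `H_L(x) = ∑ x_×ⁿ / (n+2)!`. -/
def HL (x : Vec3) : Mat3 := ∑' n : ℕ, (1 / (Nat.factorial (n + 2) : ℝ)) • skew x ^ n

/-- The estimated orientation `R̂(t) = R exp(t ω_×)`. -/
def orientation (R : Mat3) (ω : Vec3) (t : ℝ) : Mat3 := R * NormedSpace.exp (t • skew ω)

/-- The coefficient matrix `F(t)` of the linear time-varying error dynamics, where `ω` and `a` are
the bias-corrected angular velocity and acceleration and `R` is the orientation at time `0`. -/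
def errorDynamics (R : Mat3) (ω a : Vec3) (t : ℝ) : Mat15 :=
  ofBlocks
    !![-skew ω,                        0, 0, -1, 0;
       -(orientation R ω t * skew a),  0, 0, 0,  -orientation R ω t;
       0,                              1, 0, 0,  0;
       0,                              0, 0, 0,  0;
       0,                              0, 0, 0,  0]

/-- `Φ` is the state transition matrix, on the time interval `T`, of a linear system (deterministic
or driven by additive noise) with coefficient matrix `F`: for each initial time `s`, the matrix
function `t ↦ Φ(t, s)` solves `∂Φ/∂t = F(t) Φ`, `Φ(s, s) = I`. -/
def IsTransitionMatrix {ι : Type*} [Fintype ι] [DecidableEq ι] (F : ℝ → Matrix ι ι ℝ)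
    (T : Set ℝ) (Φ : ℝ → ℝ → Matrix ι ι ℝ) : Prop :=
  ∀ s ∈ T, Φ s s = 1 ∧
    ∀ t ∈ T, ∀ i j, HasDerivWithinAt (fun r => Φ r s i j) ((F t * Φ t s) i j) T t

/-- `x` solves the homogeneous linear system `ẋ = F(t) x` on the time interval `T`. -/
def IsHomogeneousSolution {ι : Type*} [Fintype ι] (F : ℝ → Matrix ι ι ℝ)
    (T : Set ℝ) (x : ℝ → ι → ℝ) : Prop :=
  ∀ t ∈ T, ∀ i, HasDerivWithinAt (fun r => x r i) ((F t *ᵥ x t) i) T t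

/-- `Δ(t) = exp(t ω_×) (I - t ω_×) - I`. -/
def Delta (ω : Vec3) (t : ℝ) : Mat3 :=
  NormedSpace.exp (t • skew ω) * (1 - t • skew ω) - 1

/-- The block `Φ_vθ(t)`. -/
def PhiVTheta (R : Mat3) (ω a : Vec3) (t : ℝ) : Mat3 :=
  -(t • (R * skew (act (JL (t • ω)) a)))

/-- The block `Φ_vω(t)`. -/
def PhiVOmega (R : Mat3) (ω a : Vec3) (t : ℝ) : Mat3 :=
  R * Delta ω t * ((1 / ‖ω‖ ^ 2) • skew a) * (1 + (1 / ‖ω‖ ^ 2) • skew ω ^ 2)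
    + t • (R * (((1 / ‖ω‖ ^ 2) • vecMulVec ω a) * (JL (-t • ω) - 1)
        + (inner ℝ a ω / ‖ω‖ ^ 2) • (JL (t • ω) - 1)))

/-- The block `Φ_va(t)`. -/
def PhiVA (R : Mat3) (ω : Vec3) (t : ℝ) : Mat3 :=
  -(t • (R * JL (t • ω)))

/-- The block `Φ_pθ(t)`. -/
def PhiPTheta (R : Mat3) (ω a : Vec3) (t : ℝ) : Mat3 :=
  -(t ^ 2 • (R * skew (act (HL (t • ω)) a)))

/-- The block `Φ_pω(t)`. -/
def PhiPOmega (R : Mat3) (ω a : Vec3) (t : ℝ) : Mat3 :=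
  R * (t • JL (t • ω) - ((1 / ‖ω‖ ^ 2) • skew ω) * Delta ω t - t • (1 : Mat3))
      * ((1 / ‖ω‖ ^ 2) • skew a) * (1 + (1 / ‖ω‖ ^ 2) • skew ω ^ 2)
    + (t ^ 2 / 2) • (R * (((1 / ‖ω‖ ^ 2) • vecMulVec ω a) * ((2 : ℝ) • HL (-t • ω) - 1)
        + (inner ℝ a ω / ‖ω‖ ^ 2) • ((2 : ℝ) • HL (t • ω) - 1)))

/-- The block `Φ_pa(t)`. -/
def PhiPA (R : Mat3) (ω : Vec3) (t : ℝ) : Mat3 :=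
  -(t ^ 2 • (R * HL (t • ω)))

/-- The closed-form `15 × 15` matrix claimed to be `Φ(t, 0)`. -/
def closedForm (R : Mat3) (ω a : Vec3) (t : ℝ) : Mat15 :=
  ofBlocks
    !![NormedSpace.exp (-t • skew ω), 0,             0, -(t • JL (-t • ω)), 0;
       PhiVTheta R ω a t,             1,             0, PhiVOmega R ω a t,  PhiVA R ω t;
       PhiPTheta R ω a t,             t • (1 : Mat3), 1, PhiPOmega R ω a t,  PhiPA R ω t;
       0,                             0,             0, 1,                  0;
       0,                             0,             0, 0,                  1]

end IMU

end

/-! Uniqueness for linear ODEs reduces the claim to one matrix: if `closedForm` solves `C' = F C`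
with `C(0) = I`, it propagates every solution, hence every column of any `Φ(·, 0)`; as it is also
invertible, `C(t) C(s)⁻¹` is a transition matrix. The equation is checked blockwise. With `K = ω_×`,
the relation `K³ = -‖ω‖² K` makes `P = I + K²/‖ω‖²` the projection onto the axis of `ω`, with `K P =
0`. Splitting `I = P - K²/‖ω‖²` expresses `t J_L(tω)` and `t² H_L(tω)` through `exp(tK)`, and gives
their derivatives `exp(tK)` and `t J_L(tω)`. The hard block is `Φ_vω` (`hasDerivAt_PhiVOmega`),
which rests on `P a_× P = 0` and `a_× ω_× = ω aᵀ - (aᵀω) I`. -/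

noncomputable section

namespace IMU

open Matrix

/-! ### Shifted exponential series in a Banach algebra, and their derivatives when `K³ = -wK`. -/

section ExpTail

variable {𝔸 : Type*} [NormedRing 𝔸] [NormedAlgebra ℝ 𝔸]

/-- The shifted exponential series `∑ xⁿ / (n+k)!`. -/
def expTail (k : ℕ) (x : 𝔸) : 𝔸 := ∑' n : ℕ, (1 / (Nat.factorial (n + k) : ℝ)) • x ^ n

theorem expTail_zero (x : 𝔸) : expTail 0 x = NormedSpace.exp x := by
  simp [expTail, NormedSpace.exp_eq_tsum ℝ]

theorem exp_smul_commute (K : 𝔸) (t : ℝ) : Commute (NormedSpace.exp (t • K)) K :=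
  ((Commute.refl K).smul_left t).exp_left

/-- Any power series in `K` times `1 + K²/w` therefore keeps only its constant term. -/
theorem mul_one_add_inv_smul_sq {K : 𝔸} {w : ℝ} (hw : w ≠ 0) (hK : K ^ 3 = -(w • K)) :
    K * (1 + (1 / w) • K ^ 2) = 0 := by
  rw [mul_add, mul_smul_comm, ← pow_succ', hK, smul_neg, smul_smul]
  simp [hw]

variable [CompleteSpace 𝔸]

theorem summable_expTail (k : ℕ) (x : 𝔸) :
    Summable fun n : ℕ => (1 / (Nat.factorial (n + k) : ℝ)) • x ^ n := by
  refine Summable.of_norm_bounded (NormedSpace.norm_expSeries_summable' (𝕂 := ℝ) x) fun n => ?_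
  rw [norm_smul, norm_smul]
  gcongr
  rw [one_div, Real.norm_of_nonneg (by positivity), Real.norm_of_nonneg (by positivity)]
  gcongr
  omega

theorem expTail_eq_add_mul (k : ℕ) (x : 𝔸) :
    expTail k x = (1 / (Nat.factorial k : ℝ)) • 1 + expTail (k + 1) x * x := by
  have h := (summable_expTail k x).tsum_eq_zero_add
  unfold expTail
  rw [h, ← (summable_expTail (k + 1) x).tsum_mul_right]
  simp [pow_succ, add_assoc, add_comm 1 k]

theorem commute_expTail (k : ℕ) (x : 𝔸) : Commute x (expTail k x) := by
  have h := summable_expTail k x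
  unfold expTail
  rw [Commute, SemiconjBy, ← h.tsum_mul_left, ← h.tsum_mul_right]
  simp only [mul_smul_comm, smul_mul_assoc, ← pow_succ, ← pow_succ']

theorem exp_eq_one_add_expTail_one_mul (x : 𝔸) :
    NormedSpace.exp x = 1 + expTail 1 x * x := by
  simpa [expTail_zero] using expTail_eq_add_mul 0 x

theorem expTail_one_eq_one_add_expTail_two_mul (x : 𝔸) :
    expTail 1 x = 1 + expTail 2 x * x := by
  simpa using expTail_eq_add_mul 1 x

theorem exp_smul_mul_exp_neg_smul (K : 𝔸) (t : ℝ) :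
    NormedSpace.exp (t • K) * NormedSpace.exp (-t • K) = 1 := by
  let := NormedAlgebra.restrictScalars ℚ ℝ 𝔸
  rw [← NormedSpace.exp_add_of_commute (((Commute.refl K).smul_left t).smul_right (-t)),
    ← add_smul]
  simp

theorem exp_neg_smul_mul_exp_smul (K : 𝔸) (t : ℝ) :
    NormedSpace.exp (-t • K) * NormedSpace.exp (t • K) = 1 := by
  simpa using exp_smul_mul_exp_neg_smul K (-t)

theorem exp_smul_mul_of_mul_eq_zero {K P : 𝔸} (h : K * P = 0) (t : ℝ) :
    NormedSpace.exp (t • K) * P = P := by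
  rw [exp_eq_one_add_expTail_one_mul, add_mul, mul_assoc, smul_mul_assoc, h]
  simp

theorem hasDerivAt_exp_smul (K : 𝔸) (t : ℝ) :
    HasDerivAt (fun u : ℝ => NormedSpace.exp (u • K)) (K * NormedSpace.exp (t • K)) t := by
  rw [← (exp_smul_commute K t).eq]
  exact hasDerivAt_exp_smul_const K t

theorem hasDerivAt_exp_neg_smul (K : 𝔸) (t : ℝ) :
    HasDerivAt (fun u : ℝ => NormedSpace.exp (-u • K)) (-(K * NormedSpace.exp (-t • K))) t := by
  simpa [Function.comp_def] using (hasDerivAt_exp_smul K (-t)).scomp t (hasDerivAt_neg t)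

theorem smul_expTail_one_mul (K : 𝔸) (t : ℝ) :
    (t • expTail 1 (t • K)) * K = NormedSpace.exp (t • K) - 1 := by
  rw [exp_eq_one_add_expTail_one_mul (t • K)]
  simp

theorem mul_smul_expTail_one_neg (K : 𝔸) (t : ℝ) :
    K * (t • expTail 1 (-t • K)) = 1 - NormedSpace.exp (-t • K) := by
  rw [exp_eq_one_add_expTail_one_mul, ← (commute_expTail 1 _).eq]
  simp

variable {K : 𝔸} {w : ℝ}

/-- On `P = 1 + K²/w` only the constant term of the series survives; on `-K²/w` one factor `K` turns
the series into `exp(tK) - 1`. The result can be differentiated without termwise arguments. -/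
theorem smul_expTail_one_eq (hw : w ≠ 0) (hK : K ^ 3 = -(w • K)) (t : ℝ) :
    t • expTail 1 (t • K) = t • (1 + (1 / w) • K ^ 2)
      - (1 / w) • ((NormedSpace.exp (t • K) - 1) * K) := by
  have h1 : expTail 1 (t • K) * (1 + (1 / w) • K ^ 2) = 1 + (1 / w) • K ^ 2 := by
    rw [expTail_one_eq_one_add_expTail_two_mul, add_mul, mul_assoc, smul_mul_assoc,
      mul_one_add_inv_smul_sq hw hK]
    simp
  rw [← smul_expTail_one_mul, ← h1]
  simp only [mul_add, mul_one, mul_smul_comm, smul_add, smul_mul_assoc, sq, mul_assoc]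
  rw [smul_comm (1 / w) t]
  abel

theorem smul_expTail_two_eq (hw : w ≠ 0) (hK : K ^ 3 = -(w • K)) (t : ℝ) :
    t ^ 2 • expTail 2 (t • K) = (t ^ 2 / 2) • (1 + (1 / w) • K ^ 2)
      - (1 / w) • ((t • expTail 1 (t • K) - t • 1) * K) := by
  have h1 : expTail 2 (t • K) * (1 + (1 / w) • K ^ 2) = (1 / 2 : ℝ) • (1 + (1 / w) • K ^ 2) := by
    rw [expTail_eq_add_mul 2, add_mul, mul_assoc, smul_mul_assoc _ K,
      mul_one_add_inv_smul_sq hw hK]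
    simp
  have h2 : t • expTail 1 (t • K) - t • 1 = t ^ 2 • (expTail 2 (t • K) * K) := by
    rw [expTail_one_eq_one_add_expTail_two_mul (t • K)]
    simp [smul_smul, sq]
  rw [h2, show t ^ 2 / 2 = t ^ 2 * (1 / 2) by ring, ← smul_smul, ← h1]
  simp only [mul_add, mul_one, mul_smul_comm, smul_add, smul_mul_assoc, sq, mul_assoc]
  rw [smul_comm (1 / w) (t * t)]
  abel

theorem hasDerivAt_smul_expTail_one (hw : w ≠ 0) (hK : K ^ 3 = -(w • K)) (t : ℝ) :
    HasDerivAt (fun u : ℝ => u • expTail 1 (u • K)) (NormedSpace.exp (t • K)) t := by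
  have h := ((hasDerivAt_id t).smul_const (1 + (1 / w) • K ^ 2)).sub
    ((((hasDerivAt_exp_smul_const K t).sub_const 1).mul_const K).const_smul (1 / w))
  refine (h.congr_of_eventuallyEq (.of_forall fun u => smul_expTail_one_eq hw hK u)).congr_deriv ?_
  have hP := exp_smul_mul_of_mul_eq_zero (mul_one_add_inv_smul_sq hw hK) t
  rw [mul_assoc, ← sq, ← mul_smul_comm, one_smul]
  -- With `P = exp(tK) P`, the two `K²` terms cancel and `exp(tK)` remains.
  nth_rewrite 1 [← hP]
  rw [mul_add, mul_one]
  abel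

theorem hasDerivAt_smul_expTail_two (hw : w ≠ 0) (hK : K ^ 3 = -(w • K)) (t : ℝ) :
    HasDerivAt (fun u : ℝ => u ^ 2 • expTail 2 (u • K)) (t • expTail 1 (t • K)) t := by
  have h := ((((hasDerivAt_id t).pow 2).div_const 2).smul_const (1 + (1 / w) • K ^ 2)).sub
    ((((hasDerivAt_smul_expTail_one hw hK t).sub ((hasDerivAt_id t).smul_const (1 : 𝔸))).mul_const
      K).const_smul (1 / w))
  refine (h.congr_of_eventuallyEq (.of_forall fun u => smul_expTail_two_eq hw hK u)).congr_deriv ?_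
  rw [smul_expTail_one_eq hw hK]
  simp

theorem hasDerivAt_smul_expTail_one_neg (hw : w ≠ 0) (hK : K ^ 3 = -(w • K)) (t : ℝ) :
    HasDerivAt (fun u : ℝ => u • expTail 1 (-u • K)) (NormedSpace.exp (-t • K)) t := by
  simpa [Function.comp_def, Pi.neg_def] using
    ((hasDerivAt_smul_expTail_one hw hK (-t)).scomp t (hasDerivAt_neg t)).neg

theorem hasDerivAt_smul_expTail_two_neg (hw : w ≠ 0) (hK : K ^ 3 = -(w • K)) (t : ℝ) :
    HasDerivAt (fun u : ℝ => u ^ 2 • expTail 2 (-u • K)) (t • expTail 1 (-t • K)) t := by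
  simpa [Function.comp_def] using
    (hasDerivAt_smul_expTail_two hw hK (-t)).scomp t (hasDerivAt_neg t)

end ExpTail

/-! ### Algebra of cross-product matrices. -/

section Skew

theorem skew_smul (c : ℝ) (x : Vec3) : skew (c • x) = c • skew x := by
  ext i j
  fin_cases i <;> fin_cases j <;> simp [skew]

/-- This is Cayley–Hamilton: the characteristic polynomial of `x_×` is `λ³ + ‖x‖² λ`. -/
theorem skew_pow_three (x : Vec3) : skew x ^ 3 = -(‖x‖ ^ 2 • skew x) := by
  rw [EuclideanSpace.real_norm_sq_eq, Fin.sum_univ_three]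
  ext i j
  fin_cases i <;> fin_cases j <;>
    simp [skew, pow_succ, Matrix.mul_apply, Fin.sum_univ_three] <;> ring

/-- Source of the `ω aᵀ` and `aᵀω` terms in the gyroscope-bias blocks. -/
theorem skew_mul_skew (a x : Vec3) :
    skew a * skew x = vecMulVec x.ofLp a.ofLp - (inner ℝ a x : ℝ) • (1 : Mat3) := by
  ext i j
  fin_cases i <;> fin_cases j <;>
    simp [skew, Matrix.mul_apply, Fin.sum_univ_three, vecMulVec_apply, PiLp.inner_apply] <;> ring

theorem skew_mul_vecMulVec (x a : Vec3) : skew x * vecMulVec x.ofLp a.ofLp = 0 := by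
  ext i j
  fin_cases i <;> fin_cases j <;>
    simp [skew, Matrix.mul_apply, Fin.sum_univ_three, vecMulVec_apply] <;> ring

/-- The axis projection `P` of `x` annihilates skew matrices: `P a_× P = 0`. -/
theorem axisProjection_mul_skew_mul_axisProjection {x : Vec3} (hx : ‖x‖ ^ 2 ≠ 0) (a : Vec3) :
    (1 + (1 / ‖x‖ ^ 2) • skew x ^ 2) * skew a * (1 + (1 / ‖x‖ ^ 2) • skew x ^ 2) = 0 := by
  have h : 1 + (1 / ‖x‖ ^ 2) • skew x ^ 2 = (1 / ‖x‖ ^ 2) • vecMulVec x.ofLp x.ofLp := by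
    rw [sq (skew x), skew_mul_skew, real_inner_self_eq_norm_sq, smul_sub, smul_smul,
      one_div_mul_cancel hx]
    simp
  rw [h]
  simp only [smul_mul_assoc, mul_smul_comm]
  -- The product contains the scalar `xᵀ a_× x = x · (a × x) = 0`.
  rw [show vecMulVec x.ofLp x.ofLp * skew a * vecMulVec x.ofLp x.ofLp = 0 from ?_]
  · simp
  ext i j
  fin_cases i <;> fin_cases j <;>
    simp [skew, Matrix.mul_apply, Fin.sum_univ_three, vecMulVec_apply] <;> ring

/-- The linear map `M ↦ (M a)_×`. -/
def skewAct (a : Vec3) : Mat3 →ₗ[ℝ] Mat3 where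
  toFun M := skew (act M a)
  map_add' M N := by
    ext i j
    fin_cases i <;> fin_cases j <;> simp [skew, act, Matrix.add_mulVec] <;> ring
  map_smul' c M := by
    ext i j
    fin_cases i <;> fin_cases j <;> simp [skew, act, Matrix.smul_mulVec]

theorem skewAct_apply (a : Vec3) (M : Mat3) : skewAct a M = skew (act M a) := rfl

theorem skewAct_one (a : Vec3) : skewAct a 1 = skew a := by
  simp [skewAct_apply, act]

theorem skew_act_skew (x y : Vec3) :
    skew (act (skew x) y) = skew x * skew y - skew y * skew x := by
  ext i j
  fin_cases i <;> fin_cases j <;>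
    simp [skew, act, dotProduct, Fin.sum_univ_three] <;> ring

theorem skewAct_skew_mul (a x : Vec3) (M : Mat3) :
    skewAct a (skew x * M) = skew x * skewAct a M - skewAct a M * skew x := by
  rw [skewAct_apply, skewAct_apply, ← skew_act_skew]
  simp [act]

end Skew

/-! ### Derivatives of the blocks of the closed form. -/

section Derivatives

attribute [local instance] Matrix.linftyOpNormedRing Matrix.linftyOpNormedAlgebra

theorem JL_smul (t : ℝ) (x : Vec3) : JL (t • x) = expTail 1 (t • skew x) := by
  rw [← skew_smul]
  rfl

theorem HL_smul (t : ℝ) (x : Vec3) : HL (t • x) = expTail 2 (t • skew x) := by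
  rw [← skew_smul]
  rfl

variable (R : Mat3) {ω : Vec3} (a : Vec3) (t : ℝ)

theorem hasDerivAt_exp_skew :
    HasDerivAt (fun u : ℝ => NormedSpace.exp (u • skew ω))
      (skew ω * NormedSpace.exp (t • skew ω)) t :=
  hasDerivAt_exp_smul (skew ω) t

theorem hasDerivAt_exp_neg_skew :
    HasDerivAt (fun u : ℝ => NormedSpace.exp (-u • skew ω))
      (-skew ω * NormedSpace.exp (-t • skew ω)) t := by
  rw [neg_mul]
  exact hasDerivAt_exp_neg_smul (skew ω) t

theorem continuous_orientation : Continuous (orientation R ω) :=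
  continuous_const.mul
    (continuous_iff_continuousAt.2 fun u => (hasDerivAt_exp_skew (ω := ω) u).continuousAt)

theorem exp_neg_skew_mul_exp_skew :
    NormedSpace.exp (-t • skew ω) * NormedSpace.exp (t • skew ω) = 1 :=
  exp_neg_smul_mul_exp_smul (skew ω) t

theorem skew_mul_smul_JL_neg :
    skew ω * (t • JL (-t • ω)) = 1 - NormedSpace.exp (-t • skew ω) := by
  rw [JL_smul]
  exact mul_smul_expTail_one_neg (skew ω) t

theorem hasDerivAt_smul_JL (hω : ‖ω‖ ^ 2 ≠ 0) :
    HasDerivAt (fun u : ℝ => u • JL (u • ω)) (NormedSpace.exp (t • skew ω)) t := by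
  simp only [JL_smul]
  exact hasDerivAt_smul_expTail_one hω (skew_pow_three ω) t

theorem hasDerivAt_smul_JL_neg (hω : ‖ω‖ ^ 2 ≠ 0) :
    HasDerivAt (fun u : ℝ => u • JL (-u • ω)) (NormedSpace.exp (-t • skew ω)) t := by
  simp only [JL_smul]
  exact hasDerivAt_smul_expTail_one_neg hω (skew_pow_three ω) t

theorem hasDerivAt_smul_HL (hω : ‖ω‖ ^ 2 ≠ 0) :
    HasDerivAt (fun u : ℝ => u ^ 2 • HL (u • ω)) (t • JL (t • ω)) t := by
  simp only [JL_smul, HL_smul]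
  exact hasDerivAt_smul_expTail_two hω (skew_pow_three ω) t

theorem hasDerivAt_smul_HL_neg (hω : ‖ω‖ ^ 2 ≠ 0) :
    HasDerivAt (fun u : ℝ => u ^ 2 • HL (-u • ω)) (t • JL (-t • ω)) t := by
  simp only [JL_smul, HL_smul]
  exact hasDerivAt_smul_expTail_two_neg hω (skew_pow_three ω) t

theorem hasDerivAt_skewAct {f : ℝ → Mat3} {f' : Mat3} (hf : HasDerivAt f f' t) :
    HasDerivAt (fun u => skewAct a (f u)) (skewAct a f') t :=
  (LinearMap.toContinuousLinearMap (skewAct a)).hasFDerivAt.comp_hasDerivAt t hf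

/-- Conjugating `a_×` by the rotation `exp(t ω_×)` rotates `a`. -/
theorem exp_mul_skew_mul_exp_neg :
    NormedSpace.exp (t • skew ω) * skew a * NormedSpace.exp (-t • skew ω)
      = skewAct a (NormedSpace.exp (t • skew ω)) := by
  -- The function `exp(-uK) (exp(uK) a)_× exp(uK)` is constant: the commutator from
  -- `skewAct_skew_mul` cancels the derivatives of the outer factors. Its value at `0` is `a_×`.
  have hd (u : ℝ) := ((hasDerivAt_exp_neg_skew (ω := ω) u).mul
    (hasDerivAt_skewAct a u (hasDerivAt_exp_skew (ω := ω) u))).mul (hasDerivAt_exp_skew (ω := ω) u)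
  have hc := is_const_of_deriv_eq_zero (fun u => (hd u).differentiableAt) (fun u => by
    have hc : skew ω * NormedSpace.exp (-u • skew ω) = NormedSpace.exp (-u • skew ω) * skew ω :=
      (exp_smul_commute (skew ω) (-u)).eq.symm
    rw [(hd u).deriv, skewAct_skew_mul, neg_mul, hc, Pi.mul_apply]
    noncomm_ring) t 0
  simp only [Pi.mul_apply, zero_smul, neg_zero, NormedSpace.exp_zero, skewAct_one, one_mul,
    mul_one] at hc
  have hE : NormedSpace.exp (t • skew ω) * NormedSpace.exp (-t • skew ω) = 1 :=
    exp_smul_mul_exp_neg_smul _ _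
  rw [← hc, ← mul_assoc, ← mul_assoc, hE, one_mul, mul_assoc, hE, mul_one]

theorem hasDerivAt_PhiVTheta (hω : ‖ω‖ ^ 2 ≠ 0) :
    HasDerivAt (PhiVTheta R ω a)
      (-(orientation R ω t * skew a) * NormedSpace.exp (-t • skew ω)) t := by
  have h := ((hasDerivAt_skewAct a t (hasDerivAt_smul_JL t hω)).const_mul R).neg
  simp only [map_smul, mul_smul_comm] at h
  refine h.congr_deriv ?_
  rw [← exp_mul_skew_mul_exp_neg, orientation]
  noncomm_ring

theorem hasDerivAt_PhiPTheta (hω : ‖ω‖ ^ 2 ≠ 0) :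
    HasDerivAt (PhiPTheta R ω a) (PhiVTheta R ω a t) t := by
  have h := ((hasDerivAt_skewAct a t (hasDerivAt_smul_HL t hω)).const_mul R).neg
  simp only [map_smul, mul_smul_comm] at h
  exact h

theorem hasDerivAt_PhiVA (hω : ‖ω‖ ^ 2 ≠ 0) :
    HasDerivAt (PhiVA R ω) (-orientation R ω t) t := by
  have h := ((hasDerivAt_smul_JL t hω).const_mul R).neg
  simp only [mul_smul_comm] at h
  exact h

theorem hasDerivAt_PhiPA (hω : ‖ω‖ ^ 2 ≠ 0) :
    HasDerivAt (PhiPA R ω) (PhiVA R ω t) t := by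
  have h := ((hasDerivAt_smul_HL t hω).const_mul R).neg
  simp only [mul_smul_comm] at h
  exact h

theorem hasDerivAt_Delta :
    HasDerivAt (Delta ω) (-(t • (skew ω ^ 2 * NormedSpace.exp (t • skew ω)))) t := by
  have h := ((hasDerivAt_exp_skew (ω := ω) t).mul
    (((hasDerivAt_id t).smul_const (skew ω)).const_sub 1)).sub_const 1
  refine h.congr_deriv ?_
  have hc : NormedSpace.exp (t • skew ω) * skew ω = skew ω * NormedSpace.exp (t • skew ω) :=
    (exp_smul_commute (skew ω) t).eq
  simp only [id, one_smul, mul_sub, mul_one, mul_neg, mul_smul_comm, mul_assoc, hc, sq]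
  abel

/-- In `exp(tK) a_× t J_L(-tω)`, the `P` part of `t J_L(-tω)` produces the derivative of the `Δ`
term and the part with a factor `K` produces the rest. -/
theorem hasDerivAt_PhiVOmega (hω : ‖ω‖ ^ 2 ≠ 0) :
    HasDerivAt (PhiVOmega R ω a)
      (-(orientation R ω t * skew a) * -(t • JL (-t • ω))) t := by
  have h1 := (((hasDerivAt_Delta (ω := ω) t).const_mul R).mul_const
    ((1 / ‖ω‖ ^ 2) • skew a)).mul_const (1 + (1 / ‖ω‖ ^ 2) • skew ω ^ 2)
  have h2 := ((((hasDerivAt_smul_JL_neg t hω).sub ((hasDerivAt_id t).smul_const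
    (1 : Mat3))).const_mul ((1 / ‖ω‖ ^ 2) • vecMulVec ω.ofLp a.ofLp)).add
    (((hasDerivAt_smul_JL t hω).sub ((hasDerivAt_id t).smul_const (1 : Mat3))).const_smul
      (inner ℝ a ω / ‖ω‖ ^ 2))).const_mul R
  refine ((h1.add h2).congr_of_eventuallyEq (.of_forall fun u => ?_)).congr_deriv ?_
  · simp only [PhiVOmega, Pi.add_apply, Pi.sub_apply, Pi.smul_apply, id, ← smul_sub, mul_smul_comm,
      smul_add, mul_add, add_right_inj]
    rw [smul_comm u (inner ℝ a ω / ‖ω‖ ^ 2)]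
  set E := NormedSpace.exp (t • skew ω) with hE
  set E' := NormedSpace.exp (-t • skew ω) with hE'
  set K := skew ω with hK
  set A := skew a
  set V := vecMulVec ω.ofLp a.ofLp
  set c : ℝ := inner ℝ a ω
  set w := ‖ω‖ ^ 2
  have hEE' : E * E' = 1 := exp_smul_mul_exp_neg_smul K t
  have hEV : E * V = V := exp_smul_mul_of_mul_eq_zero (skew_mul_vecMulVec ω a) t
  have hE'K : E' * K = K * E' := (exp_smul_commute K (-t)).eq
  have hEK : K ^ 2 * E = E * K ^ 2 := ((exp_smul_commute K t).pow_right 2).eq.symm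
  have hAK : A * K = V - c • (1 : Mat3) := skew_mul_skew a ω
  have hJ : t • JL (-t • ω) = t • (1 + (1 / w) • K ^ 2) + (1 / w) • ((E' - 1) * K) := by
    have h : -t • JL (-t • ω) = -t • (1 + (1 / w) • K ^ 2) - (1 / w) • ((E' - 1) * K) := by
      rw [JL_smul]
      exact smul_expTail_one_eq hω (skew_pow_three ω) (-t)
    rw [neg_smul t (JL _), neg_smul t (_ + _), neg_eq_iff_eq_neg] at h
    rw [h]
    abel
  -- As `P A P = 0`, also `E P A P = 0`; expanding the left `P` trades `E A P` for the factor `K² E`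
  -- of the derivative of `Δ`.
  have hP : E * A * (1 + (1 / w) • K ^ 2)
      = -((1 / w) • (K ^ 2 * E * A * (1 + (1 / w) • K ^ 2))) := by
    have h0 : (1 + (1 / w) • K ^ 2) * A * (1 + (1 / w) • K ^ 2) = 0 :=
      axisProjection_mul_skew_mul_axisProjection hω a
    have : E * (1 + (1 / w) • K ^ 2) * A * (1 + (1 / w) • K ^ 2) = 0 := by
      rw [mul_assoc, mul_assoc, ← mul_assoc _ A, h0, mul_zero]
    rw [eq_neg_iff_add_eq_zero, ← this, hEK, mul_add E, mul_one, add_mul, add_mul]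
    simp
  -- Moving `K` next to `A` gives `A K = V - c I`; then `E V = V` because `ω × ω = 0`.
  have hX : E * A * ((E' - 1) * K) = V * (E' - 1) + c • (E - 1) := by
    have e1 : E * A * (E' * K) = V * E' - c • (1 : Mat3) := by
      rw [hE'K, mul_assoc, ← mul_assoc A, hAK, ← mul_assoc, mul_sub, hEV, sub_mul]
      simp [hEE']
    have e2 : E * A * K = V - c • E := by
      rw [mul_assoc, hAK, mul_sub, hEV]
      simp
    rw [sub_mul, one_mul, mul_sub, e1, e2, mul_sub, mul_one, smul_sub]
    abel
  have hmain : E * A * (t • JL (-t • ω))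
      = -(t • (1 / w) • (K ^ 2 * E * A * (1 + (1 / w) • K ^ 2)))
        + (1 / w) • (V * (E' - 1) + c • (E - 1)) := by
    rw [hJ, mul_add, mul_smul_comm, mul_smul_comm, hP, hX, smul_neg]
  have hR : orientation R ω t * A * (t • JL (-t • ω)) = R * (E * A * (t • JL (-t • ω))) := by
    simp only [orientation, mul_assoc, hE, hK]
  rw [neg_mul_neg, hR, hmain, mul_add R (-_)]
  congr 1
  · simp only [mul_neg, neg_mul, mul_smul_comm, smul_mul_assoc, mul_assoc]
    rw [smul_comm t, smul_neg]
  · simp only [one_smul, smul_add, smul_mul_assoc, smul_smul]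
    rw [one_div_mul_eq_div]

theorem hasDerivAt_PhiPOmega (hω : ‖ω‖ ^ 2 ≠ 0) :
    HasDerivAt (PhiPOmega R ω a) (PhiVOmega R ω a t) t := by
  have h1 := ((((((hasDerivAt_smul_JL t hω).sub ((hasDerivAt_Delta (ω := ω) t).const_mul
    ((1 / ‖ω‖ ^ 2) • skew ω))).sub ((hasDerivAt_id t).smul_const (1 : Mat3)))).const_mul R).mul_const
    ((1 / ‖ω‖ ^ 2) • skew a)).mul_const (1 + (1 / ‖ω‖ ^ 2) • skew ω ^ 2)
  have hq := (((hasDerivAt_id t).pow 2).div_const 2).smul_const (1 : Mat3)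
  have h2 := ((((hasDerivAt_smul_HL_neg t hω).sub hq).const_mul
    ((1 / ‖ω‖ ^ 2) • vecMulVec ω.ofLp a.ofLp)).add
    (((hasDerivAt_smul_HL t hω).sub hq).const_smul (inner ℝ a ω / ‖ω‖ ^ 2))).const_mul R
  refine ((h1.add h2).congr_of_eventuallyEq (.of_forall fun u => ?_)).congr_deriv ?_
  · have hs (M : Mat3) : u ^ 2 • M - (u ^ 2 / 2) • 1 = (u ^ 2 / 2) • ((2 : ℝ) • M - 1) := by
      rw [smul_sub, smul_smul]
      simp
    simp only [PhiPOmega, Pi.add_apply, Pi.sub_apply, Pi.smul_apply, Pi.pow_apply, id, hs,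
      mul_smul_comm, smul_add, mul_add, add_right_inj]
    rw [smul_comm (u ^ 2 / 2) (inner ℝ a ω / ‖ω‖ ^ 2)]
  -- By `K³ = -‖ω‖² K`, the factor `t J_L(tω) - K Δ/‖ω‖² - tI` is an antiderivative of `Δ`.
  have hD : NormedSpace.exp (t • skew ω)
      - ((1 / ‖ω‖ ^ 2) • skew ω) * -(t • (skew ω ^ 2 * NormedSpace.exp (t • skew ω)))
      - (1 : Mat3) = Delta ω t := by
    rw [Delta, mul_neg, mul_smul_comm, smul_mul_assoc, ← mul_assoc, ← pow_succ', skew_pow_three,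
      neg_mul, smul_mul_assoc, smul_neg, smul_smul (1 / ‖ω‖ ^ 2), one_div_mul_cancel hω,
      show NormedSpace.exp (t • skew ω) * (1 - t • skew ω) = NormedSpace.exp (t • skew ω)
        - t • (skew ω * NormedSpace.exp (t • skew ω)) by
        rw [mul_sub, mul_one, mul_smul_comm]
        exact congrArg (_ - t • ·) (exp_smul_commute (skew ω) t).eq]
    simp
  simp only [id, one_smul, hD]
  rw [PhiVOmega]
  congr 1
  have hs (M : Mat3) : t • M - ((2 : ℕ) * t ^ (2 - 1) * 1 / 2) • (1 : Mat3) = t • (M - 1) := by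
    rw [smul_sub]
    norm_num
  simp only [hs, mul_smul_comm, smul_add, mul_add]
  rw [smul_comm t (inner ℝ a ω / ‖ω‖ ^ 2)]

end Derivatives

/-! ### Block multiplication, invertibility and initial value of the closed form. -/

section Blocks

theorem ofBlocks_mul (B C : Matrix (Fin 5) (Fin 5) Mat3) :
    ofBlocks (B * C) = ofBlocks B * ofBlocks C := by
  ext p q
  simp [ofBlocks, Matrix.mul_apply, Fintype.sum_prod_type, Matrix.sum_apply]

theorem ofBlocks_one : ofBlocks 1 = 1 := by
  ext ⟨i, i'⟩ ⟨j, j'⟩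
  by_cases h : i = j <;> simp [ofBlocks, Matrix.one_apply, h]

/-- A block matrix of the shape of the transition matrix from time `0` is right invertible if its
orientation block is. -/
theorem ofBlocks_mul_inverse {E E' : Mat3} (hE : E * E' = 1) (V W U P Q S Z T : Mat3) :
    ofBlocks !![E, 0, 0, Z, 0;
                V, 1, 0, W, U;
                P, T, 1, Q, S;
                0, 0, 0, 1, 0;
                0, 0, 0, 0, 1] *
      ofBlocks !![E', 0, 0, -(E' * Z), 0;
                  -(V * E'), 1, 0, V * E' * Z - W, -U;
                  T * V * E' - P * E', -T, 1, P * E' * Z - T * (V * E' * Z - W) - Q, T * U - S;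
                  0, 0, 0, 1, 0;
                  0, 0, 0, 0, 1] = 1 := by
  rw [← ofBlocks_mul, ← ofBlocks_one]
  congr 1
  ext1 i j
  fin_cases i <;> fin_cases j <;>
    simp [Matrix.mul_apply, Fin.sum_univ_five, hE, ← mul_assoc] <;> noncomm_ring

theorem isUnit_closedForm (R : Mat3) (ω a : Vec3) (t : ℝ) : IsUnit (closedForm R ω a t) := by
  exact IsUnit.of_mul_eq_one _
    (ofBlocks_mul_inverse (exp_neg_skew_mul_exp_skew t) _ _ _ _ _ _ _ _)

theorem closedForm_zero (R : Mat3) (ω a : Vec3) : closedForm R ω a 0 = 1 := by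
  rw [← ofBlocks_one, closedForm]
  congr 1
  ext1 i j
  fin_cases i <;> fin_cases j <;>
    simp [PhiVTheta, PhiVOmega, PhiVA, PhiPTheta, PhiPOmega, PhiPA, Delta]

end Blocks

/-! ### The closed form solves the matrix differential equation. -/

section Transition

attribute [local instance] Matrix.linftyOpNormedRing Matrix.linftyOpNormedAlgebra

theorem hasDerivAt_ofBlocks {B : ℝ → Matrix (Fin 5) (Fin 5) Mat3}
    {B' : Matrix (Fin 5) (Fin 5) Mat3} {t : ℝ}
    (hB : ∀ i j, HasDerivAt (fun u => B u i j) (B' i j) t) (p q : Fin 5 × Fin 3) :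
    HasDerivAt (fun u => ofBlocks (B u) p q) (ofBlocks B' p q) t :=
  (LinearMap.toContinuousLinearMap
    (Matrix.entryLinearMap ℝ ℝ p.2 q.2)).hasFDerivAt.comp_hasDerivAt t (hB p.1 q.1)

theorem errorDynamics_mul_closedForm (R : Mat3) (ω a : Vec3) (t : ℝ) :
    errorDynamics R ω a t * closedForm R ω a t = ofBlocks
      !![-skew ω * NormedSpace.exp (-t • skew ω), 0, 0, -NormedSpace.exp (-t • skew ω), 0;
         -(orientation R ω t * skew a) * NormedSpace.exp (-t • skew ω), 0, 0,
           -(orientation R ω t * skew a) * -(t • JL (-t • ω)), -orientation R ω t;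
         PhiVTheta R ω a t, 1, 0, PhiVOmega R ω a t, PhiVA R ω t;
         0, 0, 0, 0, 0;
         0, 0, 0, 0, 0] := by
  rw [errorDynamics, closedForm, ← ofBlocks_mul]
  congr 1
  ext1 i j
  -- The only block of the product needing more than block arithmetic: orientation against gyroscope
  -- bias.
  have h : skew ω * (t • JL (-t • ω)) + -1 = -NormedSpace.exp (-t • skew ω) := by
    rw [skew_mul_smul_JL_neg]
    abel
  rw [← h]
  fin_cases i <;> fin_cases j <;> simp [Matrix.mul_apply, Fin.sum_univ_five]

theorem hasDerivAt_closedForm (R : Mat3) {ω : Vec3} (hω : ‖ω‖ ^ 2 ≠ 0) (a : Vec3) (t : ℝ)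
    (p q : Fin 5 × Fin 3) :
    HasDerivAt (fun u => closedForm R ω a u p q)
      ((errorDynamics R ω a t * closedForm R ω a t) p q) t := by
  rw [errorDynamics_mul_closedForm]
  unfold closedForm
  refine hasDerivAt_ofBlocks (fun i j => ?_) p q
  have hconst (M : Mat3) : HasDerivAt (fun _ : ℝ => M) 0 t := hasDerivAt_const t M
  have hid : HasDerivAt (fun u : ℝ => u • (1 : Mat3)) 1 t :=
    ((hasDerivAt_id t).smul_const (1 : Mat3)).congr_deriv (one_smul ℝ _)
  match i, j with
  | 0, 0 => exact hasDerivAt_exp_neg_skew t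
  | 0, 3 => exact (hasDerivAt_smul_JL_neg t hω).neg
  | 1, 0 => exact hasDerivAt_PhiVTheta R a t hω
  | 1, 3 => exact hasDerivAt_PhiVOmega R a t hω
  | 1, 4 => exact hasDerivAt_PhiVA R t hω
  | 2, 0 => exact hasDerivAt_PhiPTheta R a t hω
  | 2, 1 => exact hid
  | 2, 3 => exact hasDerivAt_PhiPOmega R a t hω
  | 2, 4 => exact hasDerivAt_PhiPA R t hω
  | 0, 1 | 0, 2 | 0, 4 | 1, 1 | 1, 2 | 2, 2 | 3, 0 | 3, 1 | 3, 2 | 3, 3 | 3, 4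
  | 4, 0 | 4, 1 | 4, 2 | 4, 3 | 4, 4 => exact hconst _

end Transition

/-! ### Uniqueness and transition matrices for general linear systems. -/

section LinearODE

variable {ι : Type*} [Fintype ι]

attribute [local instance] Matrix.linftyOpNormedAddCommGroup in
/-- Two solutions of a homogeneous linear system with continuous coefficients agree if they agree
at the initial time. -/
theorem IsHomogeneousSolution.eq_of_initial_eq {F : ℝ → Matrix ι ι ℝ} {s τ : ℝ}
    (hF : ContinuousOn F (Set.Icc s τ)) {x y : ℝ → ι → ℝ}
    (hx : IsHomogeneousSolution F (Set.Icc s τ) x) (hy : IsHomogeneousSolution F (Set.Icc s τ) y)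
    (h0 : x s = y s) {t : ℝ} (ht : t ∈ Set.Icc s τ) : x t = y t := by
  obtain ⟨C, hC⟩ := isCompact_Icc.exists_bound_of_continuousOn hF
  have key {z : ℝ → ι → ℝ} (hz : IsHomogeneousSolution F (Set.Icc s τ) z) (u : ℝ)
      (hu : u ∈ Set.Icc s τ) : HasDerivWithinAt z (F u *ᵥ z u) (Set.Icc s τ) u :=
    hasDerivWithinAt_pi.2 (hz u hu)
  -- The uniqueness theorem uses right derivatives; for `u < τ` the interval is a right
  -- neighbourhood of `u`.
  have hmem {u : ℝ} (hu : u ∈ Set.Ico s τ) : Set.Icc s τ ∈ nhdsWithin u (Set.Ici u) :=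
    Filter.mem_of_superset (Icc_mem_nhdsGE hu.2) (Set.Icc_subset_Icc_left hu.1)
  refine ODE_solution_unique_of_mem_Icc_right (v := fun u z => F u *ᵥ z) (s := fun _ => Set.univ)
    (K := C.toNNReal) (fun u hu => ?_) (fun u hu => (key hx u hu).continuousWithinAt)
    (fun u hu => (key hx u (Set.Ico_subset_Icc_self hu)).mono_of_mem_nhdsWithin (hmem hu))
    (fun _ _ => trivial) (fun u hu => (key hy u hu).continuousWithinAt)
    (fun u hu => (key hy u (Set.Ico_subset_Icc_self hu)).mono_of_mem_nhdsWithin (hmem hu))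
    (fun _ _ => trivial) h0 ht
  refine LipschitzWith.lipschitzOnWith (LipschitzWith.of_dist_le_mul fun z z' => ?_)
  rw [dist_eq_norm, dist_eq_norm, ← Matrix.mulVec_sub]
  refine (Matrix.linfty_opNorm_mulVec _ _).trans ?_
  gcongr
  exact (hC u (Set.Ico_subset_Icc_self hu)).trans (Real.le_coe_toNNReal C)

theorem IsHomogeneousSolution.of_mulVec {F C : ℝ → Matrix ι ι ℝ} {T : Set ℝ}
    (hC : ∀ t ∈ T, ∀ i j, HasDerivWithinAt (fun r => C r i j) ((F t * C t) i j) T t)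
    (v : ι → ℝ) : IsHomogeneousSolution F T fun t => C t *ᵥ v := by
  intro t ht i
  rw [Matrix.mulVec_mulVec]
  exact HasDerivWithinAt.fun_sum fun j _ => (hC t ht i j).mul_const (v j)

/-- Right multiplication by the constant matrix `C(s)⁻¹` preserves `C' = F C` and normalizes the
value at `s`. -/
theorem IsTransitionMatrix.of_isUnit [DecidableEq ι] {F C : ℝ → Matrix ι ι ℝ} {T : Set ℝ}
    (hC : ∀ t ∈ T, ∀ i j, HasDerivWithinAt (fun r => C r i j) ((F t * C t) i j) T t)
    (hu : ∀ t ∈ T, IsUnit (C t)) : IsTransitionMatrix F T fun t s => C t * (C s)⁻¹ := by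
  refine fun s hs => ⟨Matrix.mul_nonsing_inv _ ((Matrix.isUnit_iff_isUnit_det _).1 (hu s hs)),
    fun t ht i j => ?_⟩
  rw [← mul_assoc]
  exact HasDerivWithinAt.fun_sum fun k _ => (hC t ht i k).mul_const ((C s)⁻¹ k j)

end LinearODE

theorem continuous_ofBlocks {X : Type*} [TopologicalSpace X]
    {B : X → Matrix (Fin 5) (Fin 5) Mat3} (hB : ∀ i j, Continuous fun u => B u i j) :
    Continuous fun u => ofBlocks (B u) :=
  continuous_matrix fun p q => (hB p.1 q.1).matrix_elem p.2 q.2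

theorem continuous_errorDynamics (R : Mat3) (ω a : Vec3) : Continuous (errorDynamics R ω a) := by
  have hR : Continuous (orientation R ω) := continuous_orientation R
  unfold errorDynamics
  refine continuous_ofBlocks fun i j => ?_
  fin_cases i <;> fin_cases j <;>
    first
    | exact continuous_const
    | exact hR.neg
    | exact (hR.mul continuous_const).neg

end IMU

end

/-- The error-state system has a transition matrix; any such `Φ` is given at `(t, 0)` by the closed
form; and the closed form propagates every solution of the homogeneous system from time `0`. -/
theorem proposition5
    (ωk ak bg ba : IMU.Vec3)
    (R : Matrix (Fin 3) (Fin 3) ℝ) (hR : R ∈ Matrix.specialOrthogonalGroup (Fin 3) ℝ)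
    (τ : ℝ) (hτ : 0 < τ) (hω : ωk - bg ≠ 0) :
    (∃ Φ : ℝ → ℝ → IMU.Mat15,
        IMU.IsTransitionMatrix (IMU.errorDynamics R (ωk - bg) (ak - ba)) (Set.Icc 0 τ) Φ) ∧
    (∀ Φ : ℝ → ℝ → IMU.Mat15,
        IMU.IsTransitionMatrix (IMU.errorDynamics R (ωk - bg) (ak - ba)) (Set.Icc 0 τ) Φ →
        ∀ t ∈ Set.Icc 0 τ, Φ t 0 = IMU.closedForm R (ωk - bg) (ak - ba) t) ∧
    (∀ x : ℝ → Fin 5 × Fin 3 → ℝ,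
        IMU.IsHomogeneousSolution (IMU.errorDynamics R (ωk - bg) (ak - ba)) (Set.Icc 0 τ) x →
        ∀ t ∈ Set.Icc 0 τ,
          x t = (IMU.closedForm R (ωk - bg) (ak - ba) t).mulVec (x 0)) := by
  have hw : ‖ωk - bg‖ ^ 2 ≠ 0 := by simpa using hω
  have hC (t : ℝ) (_ : t ∈ Set.Icc 0 τ) (p q : Fin 5 × Fin 3) :=
    (IMU.hasDerivAt_closedForm R hw (ak - ba) t p q).hasDerivWithinAt (s := Set.Icc 0 τ)
  have hsol (x : ℝ → Fin 5 × Fin 3 → ℝ)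
      (hx : IMU.IsHomogeneousSolution (IMU.errorDynamics R (ωk - bg) (ak - ba)) (Set.Icc 0 τ) x)
      (t : ℝ) (ht : t ∈ Set.Icc 0 τ) :
      x t = (IMU.closedForm R (ωk - bg) (ak - ba) t).mulVec (x 0) :=
    hx.eq_of_initial_eq (IMU.continuous_errorDynamics _ _ _).continuousOn
      (.of_mulVec hC (x 0)) (by simp [IMU.closedForm_zero]) ht
  refine ⟨⟨_, .of_isUnit hC fun t _ => IMU.isUnit_closedForm _ _ _ t⟩, fun Φ hΦ t ht => ?_, hsol⟩
  obtain ⟨h0, hd⟩ := hΦ 0 ⟨le_rfl, hτ.le⟩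
  -- Column `j` of `Φ(·, 0)` is the homogeneous solution starting at the basis vector `e_j`, so
  -- `hsol` determines it.
  refine Matrix.ext_of_mulVec_single fun j => ?_
  have h := hsol _ (.of_mulVec (C := fun r => Φ r 0) hd (Pi.single j 1)) t ht
  rwa [h0, Matrix.one_mulVec] at h
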